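/- For every integer $N\ge 1$ let $\mathbf r(N)=(r_1,\dots,r_m)$ and $\mathbf c(N)=(c_1,\dots,c_n)$ be non-increasing vectors of non-negative integers (their entries and their lengths $m=m(N)$, $n=n(N)$ may depend on $N$) such that $\sum_{i=1}^m r_i=\sum_{j=1}^n c_j=N$ and $r_1\ge c_1$. The configuration model generates a random $m\times n$ table $T$ as follows: take $r_i$ labelled tokens of type 1 for each row $i$ and $c_j$ labelled tokens of type 2 for each column $j$, choose a uniformly random perfect matching between the type-1 tokens and the type-2 tokens, and let $T_{i,j}$ be the number of type-1 tokens of row $i$ matched to type-2 tokens of column $j$. Let $\Omega_{\mathbf r,\mathbf c}$ be the set of $m\times n$ matrices with entries in $\{0,1\}$, row sums $\mathbf r$ and column sums $\mathbf c$. If, as $N\to\infty$, $$\sum_{i=1}^m\sum_{j=1}^n r_i(r_i-1)c_j(c_j-1)=O(N^2)\quad\text{and}\quad r_1=o(N),$$ then $\mathbb P(T\in\Omega_{\mathbf r,\mathbf c})=\Omega(1)$ as $N\to\infty$; that is, there is a constant $p>0$ such that $\mathbb P(T\in\Omega_{\mathbf r,\mathbf c})\ge p$ for all sufficiently large $N$.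 -/

import Mathlib

open Filter Asymptotics

/-- The tokens of one type: `v i` labelled tokens for each index `i`. -/
abbrev Tokens {k : ℕ} (v : Fin k → ℕ) : Type := Σ i : Fin k, Fin (v i)

/-- The first entry of a vector; the vector is extended by zeros, so it is `0` for an empty vector. -/
def firstEntry {k : ℕ} (v : Fin k → ℕ) : ℕ := if h : 0 < k then v ⟨0, h⟩ else 0

/-- The table of a matching: the entry `(i, j)` is the number of type-1 tokens of row `i` that are
matched to type-2 tokens of column `j`. -/
def tableOf {m n : ℕ} {r : Fin m → ℕ} {c : Fin n → ℕ} (σ : Tokens r ≃ Tokens c) :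
    Matrix (Fin m) (Fin n) ℕ :=
  fun i j => (Finset.univ.filter fun t : Tokens r => t.1 = i ∧ (σ t).1 = j).card

/-- The binary contingency tables with row sums `r` and column sums `c`. -/
def binaryTables {m n : ℕ} (r : Fin m → ℕ) (c : Fin n → ℕ) : Set (Matrix (Fin m) (Fin n) ℕ) :=
  {A | (∀ i j, A i j = 0 ∨ A i j = 1) ∧ (∀ i, ∑ j, A i j = r i) ∧ (∀ j, ∑ i, A i j = c j)}

theorem nonempty_matching {m n : ℕ} {r : Fin m → ℕ} {c : Fin n → ℕ}
    (h : ∑ i, r i = ∑ j, c j) : Nonempty (Tokens r ≃ Tokens c) :=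
  ⟨Fintype.equivOfCardEq (by simpa using h)⟩

/-- The configuration model: the law of the table of a uniformly random perfect matching between
type-1 tokens and type-2 tokens. -/
noncomputable def configurationModel {m n : ℕ} (r : Fin m → ℕ) (c : Fin n → ℕ)
    (h : ∑ i, r i = ∑ j, c j) : PMF (Matrix (Fin m) (Fin n) ℕ) :=
  haveI : Nonempty (Tokens r ≃ Tokens c) := nonempty_matching h
  (PMF.uniformOfFintype (Tokens r ≃ Tokens c)).map tableOf

/-!
A table fails to be binary exactly when two tokens of one row are matched to two tokens of one
column. Each such bad event prescribes the images of two tokens, so it has probability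
`1 / (N (N - 1))`, and there are `A * B` of them, where `A = ∑ rᵢ (rᵢ - 1)` and
`B = ∑ cⱼ (cⱼ - 1)`; hence their expected number is bounded.

The bad events are not independent, but bijections satisfy a negative correlation property: if a
family of events involves no token of the event `σ s = t ∧ σ s' = t'`, then avoiding the family does
not make this event more likely (`card_prescribed_pair_and_avoid_le`). Indeed, composing with a
permutation that moves `t, t'` to `u, u'` and fixes all other points carries the avoiding bijections
with images `t, t'` injectively to avoiding bijections with images `u, u'`, for every `u ≠ u'`. The
lopsided form of the Lovász local lemma (`one_sub_pow_card_mul_le_card_avoid`) therefore bounds the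
probability that no bad event occurs below by `(1 - 2 / (N (N - 1))) ^ (A * B)`, provided that each
bad event shares a token with at most `N (N - 1) / 4` others.

The number of bad events sharing a token with a given one is at most `4 (r₁ B + c₁ A)`, so it
remains to see that `r₁ B + c₁ A = o(N²)` (`first_mul_pairs_add_le`). Since `r₁² ≲ A` and
`A B = O(N²)`, the term `r₁ B` is `O(N² / r₁)`, which settles the case of large `r₁`; for bounded
`r₁` it is at most `r₁ c₁ N ≤ r₁² N = O(N)`. Likewise `c₁ A = O(N² / c₁)`, and for bounded `c₁`
it is at most `c₁ r₁ N = o(N²)` because `r₁ = o(N)`.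
-/

/-! ### The lopsided local lemma -/

section LocalLemma

variable {Ω ι : Type*} [Fintype Ω]

open Classical in
/-- The points of `Ω` at which none of the events `E e`, `e ∈ S`, occurs. -/
noncomputable def avoid (E : ι → Ω → Prop) (S : Finset ι) : Finset Ω :=
  Finset.univ.filter fun ω => ∀ e ∈ S, ¬ E e ω

theorem mem_avoid {E : ι → Ω → Prop} {S : Finset ι} {ω : Ω} :
    ω ∈ avoid E S ↔ ∀ e ∈ S, ¬ E e ω := by
  simp [avoid]

theorem avoid_anti {E : ι → Ω → Prop} {S S' : Finset ι} (h : S ⊆ S') :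
    avoid E S' ⊆ avoid E S := fun _ hω =>
  mem_avoid.2 fun e he => mem_avoid.1 hω e (h he)

open Classical in
/-- Union bound: passing from the family `S` to `S ∪ S'` loses at most the points at which an event
of `S'` occurs. -/
theorem card_avoid_le_add_sum (E : ι → Ω → Prop) (S S' : Finset ι) :
    (avoid E S).card ≤
      (avoid E (S ∪ S')).card + ∑ e ∈ S', ((avoid E S).filter (E e)).card := by
  have hsub : avoid E S ⊆ avoid E (S ∪ S') ∪ S'.biUnion fun e => (avoid E S).filter (E e) := by
    intro ω hω
    by_cases h : ∃ e ∈ S', E e ω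
    · obtain ⟨e, he, hE⟩ := h
      exact Finset.mem_union_right _
        (Finset.mem_biUnion.2 ⟨e, he, Finset.mem_filter.2 ⟨hω, hE⟩⟩)
    · refine Finset.mem_union_left _ (mem_avoid.2 fun e he hE => ?_)
      rcases Finset.mem_union.1 he with he | he
      · exact mem_avoid.1 hω e he hE
      · exact h ⟨e, he, hE⟩
  exact (Finset.card_le_card hsub).trans
    ((Finset.card_union_le _ _).trans (Nat.add_le_add_left Finset.card_biUnion_le _))

open Classical in
/-- Conditioning on the avoidance of any family of events at most doubles the bound `p` on the
probability of a further event. Here `nbr e f` is the dependency relation: conditioning on avoiding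
events unrelated to `e` preserves the bound. -/
theorem card_filter_avoid_le (E : ι → Ω → Prop) (T : Finset ι) (nbr : ι → ι → Prop) {p : ℝ}
    (hp : 0 ≤ p)
    (hlop : ∀ e ∈ T, ∀ S ⊆ T, (∀ f ∈ S, ¬ nbr e f) →
      (((avoid E S).filter (E e)).card : ℝ) ≤ p * (avoid E S).card)
    (hnbr : ∀ e ∈ T, 4 * p * ((T.filter (nbr e)).card : ℝ) ≤ 1)
    (S : Finset ι) (hS : S ⊆ T) :
    ∀ e ∈ T, (((avoid E S).filter (E e)).card : ℝ) ≤ 2 * p * (avoid E S).card := by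
  induction S using Finset.strongInduction with
  | H S ih =>
    intro e he
    set S₁ := S.filter (nbr e)
    set S₂ := S.filter fun f => ¬ nbr e f
    have hunion : S₂ ∪ S₁ = S := by
      rw [Finset.union_comm]; exact Finset.filter_union_filter_not_eq _ _
    have hS₂S : S₂ ⊆ S := Finset.filter_subset _ _
    have hnum : (((avoid E S).filter (E e)).card : ℝ) ≤ p * (avoid E S₂).card := by
      refine le_trans ?_ (hlop e he S₂ (hS₂S.trans hS) fun f hf => (Finset.mem_filter.1 hf).2)
      exact_mod_cast Finset.card_le_card (Finset.filter_subset_filter _ (avoid_anti hS₂S))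
    -- The avoidance of the neighbours costs at most half of the points, by the induction hypothesis.
    have hden : ((avoid E S₂).card : ℝ) ≤ 2 * (avoid E S).card := by
      have hcover : ((avoid E S₂).card : ℝ) ≤
          (avoid E S).card + ∑ f ∈ S₁, (((avoid E S₂).filter (E f)).card : ℝ) := by
        have h := card_avoid_le_add_sum E S₂ S₁
        rw [hunion] at h
        exact_mod_cast h
      have hsum : ∑ f ∈ S₁, (((avoid E S₂).filter (E f)).card : ℝ) ≤
          S₁.card * (2 * p * (avoid E S₂).card) := by
        rw [← nsmul_eq_mul]
        refine Finset.sum_le_card_nsmul _ _ _ fun f hf => ?_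
        have hfS := Finset.mem_filter.1 hf
        refine ih S₂ (Finset.ssubset_iff_subset_ne.2 ⟨hS₂S, fun h => ?_⟩) (hS₂S.trans hS) f
          (hS hfS.1)
        exact (Finset.mem_filter.1 (h ▸ hfS.1 : f ∈ S₂)).2 hfS.2
      have hcard : (S₁.card : ℝ) ≤ (T.filter (nbr e)).card := by
        exact_mod_cast Finset.card_le_card (Finset.filter_subset_filter _ hS)
      have hhalf : 4 * p * (S₁.card : ℝ) ≤ 1 :=
        (mul_le_mul_of_nonneg_left hcard (by positivity)).trans (hnbr e he)
      have hprod := mul_le_mul_of_nonneg_right hhalf (Nat.cast_nonneg (α := ℝ) (avoid E S₂).card)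
      linarith
    have := mul_le_mul_of_nonneg_left hden hp
    linarith

open Classical in
/-- The lopsided Lovász local lemma for a uniform point of a finite type and events of probability
at most `p`. -/
theorem one_sub_pow_card_mul_le_card_avoid (E : ι → Ω → Prop) (T : Finset ι)
    (nbr : ι → ι → Prop) {p : ℝ} (hp : 0 ≤ p) (hp' : 2 * p ≤ 1)
    (hlop : ∀ e ∈ T, ∀ S ⊆ T, (∀ f ∈ S, ¬ nbr e f) →
      (((avoid E S).filter (E e)).card : ℝ) ≤ p * (avoid E S).card)
    (hnbr : ∀ e ∈ T, 4 * p * ((T.filter (nbr e)).card : ℝ) ≤ 1) :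
    (1 - 2 * p) ^ T.card * (Fintype.card Ω : ℝ) ≤ (avoid E T).card := by
  suffices h : ∀ S ⊆ T, (1 - 2 * p) ^ S.card * (Fintype.card Ω : ℝ) ≤ (avoid E S).card from
    h T subset_rfl
  intro S
  induction S using Finset.induction_on with
  | empty => intro _; simp [avoid]
  | insert e S heS ih =>
    intro hS
    have heT := hS (Finset.mem_insert_self e S)
    have hST := (Finset.subset_insert e S).trans hS
    have hev := card_filter_avoid_le E T nbr hp hlop hnbr S hST e heT
    have hcover : ((avoid E S).card : ℝ) ≤
        (avoid E (insert e S)).card + ((avoid E S).filter (E e)).card := by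
      have h := card_avoid_le_add_sum E S {e}
      rw [Finset.sum_singleton, Finset.union_comm, ← Finset.insert_eq] at h
      exact_mod_cast h
    have := mul_le_mul_of_nonneg_left (ih hST) (sub_nonneg.2 hp')
    rw [Finset.card_insert_of_notMem heS, pow_succ']
    linarith

end LocalLemma

/-! ### Negative correlation for uniform bijections -/

section Bijections

variable {α β : Type*}

/-- The event that a bijection `σ` maps the pair `e.1` of points to the pair `e.2`. -/
def MapsPair (e : (α × α) × (β × β)) (σ : α ≃ β) : Prop :=
  σ e.1.1 = e.2.1 ∧ σ e.1.2 = e.2.2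

/-- The pairs `x` and `y` have a point in common. -/
def SharePoint {γ : Type*} (x y : γ × γ) : Prop :=
  y.1 = x.1 ∨ y.1 = x.2 ∨ y.2 = x.1 ∨ y.2 = x.2

/-- Two prescriptions of the images of a pair of points interfere if they have a source point or a
target point in common. -/
def Interferes (e f : (α × α) × (β × β)) : Prop :=
  SharePoint e.1 f.1 ∨ SharePoint e.2 f.2

/-- An ordered pair of distinct points can be moved to any other one by a permutation that fixes
all points outside the two pairs. -/
theorem exists_perm_moving_pair [DecidableEq β] {t t' u u' : β} (ht : t ≠ t') (hu : u ≠ u') :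
    ∃ π : Equiv.Perm β, π t = u ∧ π t' = u' ∧
      ∀ q, q ≠ t → q ≠ t' → q ≠ u → q ≠ u' → π q = q := by
  have hne : Equiv.swap t u t' ≠ u := fun h =>
    ht ((Equiv.swap t u).injective ((Equiv.swap_apply_left t u).trans h.symm))
  refine ⟨Equiv.swap (Equiv.swap t u t') u' * Equiv.swap t u, ?_, ?_, fun q h₁ h₂ h₃ h₄ => ?_⟩
  · rw [Equiv.Perm.mul_apply, Equiv.swap_apply_left, Equiv.swap_apply_of_ne_of_ne hne.symm hu]
  · rw [Equiv.Perm.mul_apply, Equiv.swap_apply_left]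
  · have hq : Equiv.swap t u q = q := Equiv.swap_apply_of_ne_of_ne h₁ h₃
    have hq' : q ≠ Equiv.swap t u t' := fun h =>
      h₂ ((Equiv.swap t u).injective (hq.trans h))
    rw [Equiv.Perm.mul_apply, hq, Equiv.swap_apply_of_ne_of_ne hq' h₄]

variable [Fintype α] [Fintype β] [DecidableEq α] [DecidableEq β]

open Classical in
/-- Among the bijections avoiding prescriptions that do not interfere with `e`, no prescription of
the images of `e.1` is rarer than `e` itself. -/
theorem card_mapsPair_le_card_mapsPair (e : (α × α) × (β × β)) (he : e.2.1 ≠ e.2.2)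
    (S : Finset ((α × α) × (β × β))) (hS : ∀ f ∈ S, ¬ Interferes e f)
    {w : β × β} (hw : w.1 ≠ w.2) :
    ((avoid MapsPair S).filter (MapsPair e)).card ≤
      ((avoid MapsPair S).filter (MapsPair (e.1, w))).card := by
  obtain ⟨π, hπ, hπ', hfix⟩ := exists_perm_moving_pair he hw
  refine Finset.card_le_card_of_injOn (fun σ => σ.trans π) ?_ ?_
  · intro σ hσ
    obtain ⟨hav, hσ₁, hσ₂⟩ := Finset.mem_filter.1 hσ
    have hw₁ : π (σ e.1.1) = w.1 := by rw [hσ₁, hπ]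
    have hw₂ : π (σ e.1.2) = w.2 := by rw [hσ₂, hπ']
    -- Where the new bijection `π ∘ σ` sends a point outside `e.1` to a point outside `e.2`, it agrees
    -- with `σ`.
    have hback : ∀ p q, p ≠ e.1.1 → p ≠ e.1.2 → q ≠ e.2.1 → q ≠ e.2.2 →
        π (σ p) = q → σ p = q := by
      intro p q hp hp' hq hq' h
      have hπq : π q = q := by
        refine hfix q hq hq' (fun hqw => hp ?_) fun hqw => hp' ?_
        · exact σ.injective (π.injective (by rw [h, hw₁, hqw]))
        · exact σ.injective (π.injective (by rw [h, hw₂, hqw]))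
      exact π.injective (h.trans hπq.symm)
    refine Finset.mem_coe.2 (Finset.mem_filter.2 ⟨mem_avoid.2 fun f hf hE => ?_, hw₁, hw₂⟩)
    have hdisj := hS f hf
    simp only [Interferes, SharePoint, not_or] at hdisj
    obtain ⟨⟨h₁, h₂, h₃, h₄⟩, h₅, h₆, h₇, h₈⟩ := hdisj
    exact mem_avoid.1 hav f hf
      ⟨hback _ _ h₁ h₂ h₅ h₆ hE.1, hback _ _ h₃ h₄ h₇ h₈ hE.2⟩
  · intro σ _ τ _ h
    ext x
    exact π.injective (DFunLike.congr_fun h x)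

open Classical in
/-- Avoiding prescriptions that do not interfere with `e` does not increase the probability
`1 / (N (N - 1))` of `e`. -/
theorem card_prescribed_pair_and_avoid_le (e : (α × α) × (β × β)) (he : e.2.1 ≠ e.2.2)
    (S : Finset ((α × α) × (β × β))) (hS : ∀ f ∈ S, ¬ Interferes e f) :
    (Fintype.card β * Fintype.card β - Fintype.card β) *
        ((avoid MapsPair S).filter (MapsPair e)).card ≤ (avoid MapsPair S).card := by
  have hoff : (Finset.univ : Finset β).offDiag.card =
      Fintype.card β * Fintype.card β - Fintype.card β := by
    rw [Finset.offDiag_card, Finset.card_univ]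
  rw [← hoff, ← smul_eq_mul]
  calc _ ≤ ∑ w ∈ (Finset.univ : Finset β).offDiag,
        ((avoid MapsPair S).filter (MapsPair (e.1, w))).card :=
        Finset.card_nsmul_le_sum _ _ _ fun w hw =>
          card_mapsPair_le_card_mapsPair e he S hS (Finset.mem_offDiag.1 hw).2.2
    _ = (Finset.univ.offDiag.biUnion fun w =>
          (avoid MapsPair S).filter (MapsPair (e.1, w))).card := by
        refine (Finset.card_biUnion fun w _ w' _ hww' => ?_).symm
        refine Finset.disjoint_left.2 fun σ hσ hσ' => hww' ?_
        have h := (Finset.mem_filter.1 hσ).2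
        have h' := (Finset.mem_filter.1 hσ').2
        exact Prod.ext (h.1.symm.trans h'.1) (h.2.symm.trans h'.2)
    _ ≤ (avoid MapsPair S).card :=
        Finset.card_le_card (Finset.biUnion_subset.2 fun _ _ => Finset.filter_subset _ _)

end Bijections

/-! ### Counting pairs of tokens -/

section TokenPairs

variable {k : ℕ} (v : Fin k → ℕ)

/-- The ordered pairs of distinct tokens with the same index. -/
def tokenPairs : Finset (Tokens v × Tokens v) :=
  Finset.univ.filter fun x => x.1.1 = x.2.1 ∧ x.1 ≠ x.2

variable {v}

theorem mem_tokenPairs {x : Tokens v × Tokens v} :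
    x ∈ tokenPairs v ↔ x.1.1 = x.2.1 ∧ x.1 ≠ x.2 := by
  simp [tokenPairs]

theorem card_filter_token_index (i : Fin k) :
    ((Finset.univ : Finset (Tokens v)).filter fun x => x.1 = i).card = v i := by
  have h : ((Finset.univ : Finset (Tokens v)).filter fun x => x.1 = i) =
      Finset.univ.map (Function.Embedding.sigmaMk i) := by
    ext ⟨j, a⟩
    simp only [Finset.mem_filter, Finset.mem_univ, true_and, Finset.mem_map,
      Function.Embedding.sigmaMk_apply]
    constructor
    · rintro rfl
      exact ⟨a, rfl⟩
    · rintro ⟨b, hb⟩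
      exact (congrArg Sigma.fst hb).symm
  rw [h, Finset.card_map, Finset.card_univ, Fintype.card_fin]

theorem card_tokenPairs_left (x : Tokens v) :
    ((tokenPairs v).filter fun y => y.1 = x).card = v x.1 - 1 := by
  have h : ((tokenPairs v).filter fun y => y.1 = x) =
      (((Finset.univ : Finset (Tokens v)).filter fun y => y.1 = x.1).erase x).image
        fun y => (x, y) := by
    ext ⟨a, b⟩
    simp only [Finset.mem_filter, mem_tokenPairs, Finset.mem_image, Finset.mem_erase,
      Finset.mem_univ, true_and, Prod.mk.injEq]
    constructor
    · rintro ⟨⟨h₁, h₂⟩, rfl⟩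
      exact ⟨b, ⟨Ne.symm h₂, h₁.symm⟩, rfl, rfl⟩
    · rintro ⟨y, ⟨h₁, h₂⟩, rfl, rfl⟩
      exact ⟨⟨h₂.symm, Ne.symm h₁⟩, rfl⟩
  rw [h, Finset.card_image_of_injective _ fun _ _ h => (Prod.ext_iff.1 h).2,
    Finset.card_erase_of_mem (by simp), card_filter_token_index]

theorem card_tokenPairs_right (x : Tokens v) :
    ((tokenPairs v).filter fun y => y.2 = x).card = v x.1 - 1 := by
  rw [← card_tokenPairs_left x]
  refine Finset.card_bij' (fun y _ => y.swap) (fun y _ => y.swap) ?_ ?_ ?_ ?_ <;>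
    simp +contextual [mem_tokenPairs, eq_comm]

theorem card_tokenPairs (v : Fin k → ℕ) : (tokenPairs v).card = ∑ i, v i * (v i - 1) := by
  rw [Finset.card_eq_sum_card_fiberwise (f := Prod.fst) (t := Finset.univ)
    fun _ _ => Finset.mem_coe.2 (Finset.mem_univ _)]
  simp only [card_tokenPairs_left]
  rw [Fintype.sum_sigma]
  simp

theorem le_firstEntry (hv : Antitone v) (i : Fin k) : v i ≤ firstEntry v := by
  have hk : 0 < k := i.pos
  rw [firstEntry, dif_pos hk]
  exact hv (Nat.zero_le i.1)

theorem card_tokenPairs_le (hv : Antitone v) :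
    (tokenPairs v).card ≤ firstEntry v * ∑ i, v i := by
  rw [card_tokenPairs, Finset.mul_sum]
  refine Finset.sum_le_sum fun i _ => ?_
  rw [mul_comm]
  exact Nat.mul_le_mul_right _ ((Nat.sub_le _ _).trans (le_firstEntry hv i))

theorem firstEntry_mul_pred_le (v : Fin k → ℕ) :
    firstEntry v * (firstEntry v - 1) ≤ (tokenPairs v).card := by
  rw [card_tokenPairs, firstEntry]
  split_ifs with hk
  · exact Finset.single_le_sum (f := fun i => v i * (v i - 1)) (fun _ _ => Nat.zero_le _)
      (Finset.mem_univ _)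
  · simp

open Classical in
theorem card_tokenPairs_sharePoint_le (hv : Antitone v) (x : Tokens v × Tokens v) :
    ((tokenPairs v).filter (SharePoint x)).card ≤ 4 * firstEntry v := by
  have hl : ∀ a : Tokens v, ((tokenPairs v).filter fun y => y.1 = a).card ≤ firstEntry v :=
    fun a => by
      rw [card_tokenPairs_left]; exact (Nat.sub_le _ _).trans (le_firstEntry hv _)
  have hr : ∀ a : Tokens v, ((tokenPairs v).filter fun y => y.2 = a).card ≤ firstEntry v :=
    fun a => by
      rw [card_tokenPairs_right]; exact (Nat.sub_le _ _).trans (le_firstEntry hv _)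
  have hsplit : (tokenPairs v).filter (SharePoint x) =
      (tokenPairs v).filter (fun y => y.1 = x.1) ∪ ((tokenPairs v).filter (fun y => y.1 = x.2) ∪
        ((tokenPairs v).filter (fun y => y.2 = x.1) ∪
          (tokenPairs v).filter fun y => y.2 = x.2)) := by
    ext y
    simp only [SharePoint, Finset.mem_filter, Finset.mem_union]
    tauto
  rw [hsplit]
  refine (Finset.card_union_le _ _).trans ?_
  refine (Nat.add_le_add_left (Finset.card_union_le _ _) _).trans ?_
  refine (Nat.add_le_add_left (Nat.add_le_add_left (Finset.card_union_le _ _) _) _).trans ?_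
  have h₁ := hl x.1
  have h₂ := hl x.2
  have h₃ := hr x.1
  have h₄ := hr x.2
  omega

theorem cast_mul_pred (a : ℕ) : ((a * (a - 1) : ℕ) : ℝ) = (a : ℝ) * ((a : ℝ) - 1) := by
  cases a <;> simp

theorem sum_sum_eq_card_mul_card {l : ℕ} (v : Fin k → ℕ) (w : Fin l → ℕ) :
    ∑ i, ∑ j, (v i : ℝ) * ((v i : ℝ) - 1) * (w j : ℝ) * ((w j : ℝ) - 1) =
      (tokenPairs v).card * (tokenPairs w).card := by
  simp only [card_tokenPairs, Nat.cast_sum, cast_mul_pred]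
  rw [Finset.sum_mul_sum]
  simp only [mul_assoc]

end TokenPairs

/-! ### The configuration model -/

section ConfigurationModel

variable {m n : ℕ} {r : Fin m → ℕ} {c : Fin n → ℕ}

theorem tableOf_mem_binaryTables {σ : Tokens r ≃ Tokens c}
    (hσ : σ ∈ avoid MapsPair (tokenPairs r ×ˢ tokenPairs c)) :
    tableOf σ ∈ binaryTables r c := by
  refine ⟨fun i j => ?_, fun i => ?_, fun j => ?_⟩
  · rw [← Nat.le_one_iff_eq_zero_or_eq_one]
    refine Finset.card_le_one.2 fun s hs s' hs' => ?_
    simp only [Finset.mem_filter, Finset.mem_univ, true_and] at hs hs'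
    by_contra hne
    refine mem_avoid.1 hσ ((s, s'), (σ s, σ s')) (Finset.mem_product.2 ⟨?_, ?_⟩) ⟨rfl, rfl⟩
    · exact mem_tokenPairs.2 ⟨hs.1.trans hs'.1.symm, hne⟩
    · exact mem_tokenPairs.2 ⟨hs.2.trans hs'.2.symm, σ.injective.ne hne⟩
  · rw [← card_filter_token_index (v := r) i,
      Finset.card_eq_sum_card_fiberwise (f := fun t => (σ t).1) (t := Finset.univ)
        fun _ _ => Finset.mem_coe.2 (Finset.mem_univ _)]
    simp only [tableOf, Finset.filter_filter]
  · have hcol : (Finset.univ.filter fun t : Tokens r => (σ t).1 = j).card = c j := by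
      rw [← card_filter_token_index (v := c) j]
      exact Finset.card_equiv σ (by simp)
    rw [← hcol, Finset.card_eq_sum_card_fiberwise (f := fun t : Tokens r => t.1)
        (t := Finset.univ) fun _ _ => Finset.mem_coe.2 (Finset.mem_univ _)]
    simp only [tableOf, Finset.filter_filter, and_comm]

theorem card_avoid_div_le_configurationModel (h : ∑ i, r i = ∑ j, c j) :
    ((avoid MapsPair (tokenPairs r ×ˢ tokenPairs c)).card : ℝ) /
        Fintype.card (Tokens r ≃ Tokens c) ≤
      ((configurationModel r c h).toOuterMeasure (binaryTables r c)).toReal := by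
  classical
  have : Nonempty (Tokens r ≃ Tokens c) := nonempty_matching h
  rw [configurationModel, PMF.toOuterMeasure_map_apply, PMF.toOuterMeasure_uniformOfFintype_apply,
    ENNReal.toReal_div, ENNReal.toReal_natCast, ENNReal.toReal_natCast]
  refine div_le_div_of_nonneg_right ?_ (Nat.cast_nonneg _)
  rw [← Set.toFinset_card]
  have hsub : avoid MapsPair (tokenPairs r ×ˢ tokenPairs c) ⊆
      (tableOf ⁻¹' binaryTables r c).toFinset := fun σ hσ =>
    Set.mem_toFinset.2 (tableOf_mem_binaryTables hσ)
  exact_mod_cast Finset.card_le_card hsub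

open Classical in
theorem card_filter_interferes_le (hr : Antitone r) (hc : Antitone c)
    (e : (Tokens r × Tokens r) × (Tokens c × Tokens c)) :
    ((tokenPairs r ×ˢ tokenPairs c).filter (Interferes e)).card ≤
      4 * (firstEntry r * (tokenPairs c).card + firstEntry c * (tokenPairs r).card) := by
  have hsub : (tokenPairs r ×ˢ tokenPairs c).filter (Interferes e) ⊆
      (tokenPairs r).filter (SharePoint e.1) ×ˢ tokenPairs c ∪
        tokenPairs r ×ˢ (tokenPairs c).filter (SharePoint e.2) := by
    intro f hf
    simp only [Finset.mem_filter, Finset.mem_product, Finset.mem_union, Interferes] at hf ⊢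
    tauto
  refine (Finset.card_le_card hsub).trans ((Finset.card_union_le _ _).trans ?_)
  rw [Finset.card_product, Finset.card_product]
  have h₁ := Nat.mul_le_mul_right (tokenPairs c).card (card_tokenPairs_sharePoint_le hr e.1)
  have h₂ := Nat.mul_le_mul_left (tokenPairs r).card (card_tokenPairs_sharePoint_le hc e.2)
  linarith

/-- The local lemma applied to the configuration model: a non-asymptotic lower bound for the
probability of a binary table. -/
theorem one_sub_pow_le_configurationModel {N : ℕ} (hN : 2 ≤ N) (hr : ∑ i, r i = N)
    (hc : ∑ j, c j = N) (hr_anti : Antitone r) (hc_anti : Antitone c)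
    (hsmall : 16 * ((firstEntry r : ℝ) * (tokenPairs c).card +
      firstEntry c * (tokenPairs r).card) ≤ (N : ℝ) * (N - 1)) :
    (1 - 2 * ((N : ℝ) * (N - 1))⁻¹) ^ ((tokenPairs r).card * (tokenPairs c).card) ≤
      ((configurationModel r c (hr.trans hc.symm)).toOuterMeasure (binaryTables r c)).toReal := by
  classical
  have hN' : (2 : ℝ) ≤ N := by exact_mod_cast hN
  have hpos : (2 : ℝ) ≤ (N : ℝ) * (N - 1) := by nlinarith
  have : Nonempty (Tokens r ≃ Tokens c) := nonempty_matching (hr.trans hc.symm)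
  refine le_trans ?_ (card_avoid_div_le_configurationModel _)
  rw [le_div_iff₀ (by exact_mod_cast Fintype.card_pos), ← Finset.card_product]
  refine one_sub_pow_card_mul_le_card_avoid MapsPair _ Interferes (by positivity) ?_ ?_ ?_
  · rw [← div_eq_mul_inv, div_le_one (by linarith)]
    exact hpos
  · intro e he S _ hS
    have hne := (mem_tokenPairs.1 (Finset.mem_product.1 he).2).2
    have h := card_prescribed_pair_and_avoid_le e hne S hS
    have hcard : Fintype.card (Tokens c) = N := by simpa using hc
    rw [hcard, ← Nat.mul_sub_one] at h
    rw [inv_mul_eq_div, le_div_iff₀ (by linarith), ← cast_mul_pred, mul_comm]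
    exact_mod_cast h
  · intro e _
    have h : (((tokenPairs r ×ˢ tokenPairs c).filter (Interferes e)).card : ℝ) ≤
        4 * (firstEntry r * (tokenPairs c).card + firstEntry c * (tokenPairs r).card) := by
      exact_mod_cast card_filter_interferes_le hr_anti hc_anti e
    rw [mul_assoc, mul_left_comm, inv_mul_eq_div, div_le_one (by linarith)]
    linarith

end ConfigurationModel

/-! ### Asymptotics -/

/-- If `x² ≤ 2 P` and `P Q ≤ K M`, then `x Q` is at most `2 K M / x`, hence small for large `x`. -/
theorem mul_le_of_sq_le {x P Q K M : ℝ} (hK : 0 < K) (hQ : 0 ≤ Q) (hx : x ^ 2 ≤ 2 * P)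
    (hPQ : P * Q ≤ K * M) (hlarge : 128 * K ≤ x) (hM : 0 ≤ M) : x * Q ≤ M / 64 := by
  have hx0 : 0 < x := by linarith
  have h₁ : x * (x * Q) ≤ 2 * K * M := by nlinarith [mul_le_mul_of_nonneg_right hx hQ]
  have h₂ : 2 * K * M ≤ x * (M / 64) := by nlinarith [mul_le_mul_of_nonneg_right hlarge hM]
  exact le_of_mul_le_mul_left (h₁.trans h₂) hx0

/-- With `a, b` the largest row and column sums and `A, B` the numbers of pairs of tokens in a
common row and column, a bad event interferes with few others. -/
theorem first_mul_pairs_add_le {a b A B K N : ℝ} (hK : 1 ≤ K) (hb : 0 ≤ b) (hba : b ≤ a)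
    (hA : 0 ≤ A) (hB : 0 ≤ B) (haA : a * (a - 1) ≤ A) (hbB : b * (b - 1) ≤ B)
    (hAN : A ≤ a * N) (hBN : B ≤ b * N) (hAB : A * B ≤ K * N ^ 2)
    (ha : a ≤ N / (64 * (128 * K))) (hN : 64 * (128 * K) ^ 2 ≤ N) :
    a * B + b * A ≤ N ^ 2 / 32 := by
  have hN0 : 0 < N := lt_of_lt_of_le (by positivity) hN
  have h₁ : a * B ≤ N ^ 2 / 64 := by
    rcases le_total (128 * K) a with h | h
    · exact mul_le_of_sq_le (by linarith) hB (by nlinarith) hAB h (by positivity)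
    · calc a * B ≤ a * (b * N) := mul_le_mul_of_nonneg_left hBN (hb.trans hba)
        _ ≤ (128 * K) * ((128 * K) * N) := by
            have := hba.trans h
            gcongr
        _ ≤ N ^ 2 / 64 := by nlinarith [mul_le_mul_of_nonneg_right hN hN0.le]
  have h₂ : b * A ≤ N ^ 2 / 64 := by
    rcases le_total (128 * K) b with h | h
    · exact mul_le_of_sq_le (P := B) (by linarith) hA (by nlinarith) (by linarith) h
        (by positivity)
    · have ha0 : 0 ≤ a := hb.trans hba
      calc b * A ≤ b * (a * N) := mul_le_mul_of_nonneg_left hAN hb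
        _ ≤ (128 * K) * (N / (64 * (128 * K)) * N) := by gcongr
        _ = N ^ 2 / 64 := by field_simp
  linarith

theorem exp_neg_two_mul_le_one_sub {x : ℝ} (hx : 0 ≤ x) (hx' : x ≤ 1 / 2) :
    Real.exp (-(2 * x)) ≤ 1 - x := by
  rw [Real.exp_neg, inv_le_iff_one_le_mul₀ (Real.exp_pos _)]
  nlinarith [Real.add_one_le_exp (2 * x)]

theorem proposition2
    (m n : ℕ → ℕ)
    (r : (N : ℕ) → Fin (m N) → ℕ) (c : (N : ℕ) → Fin (n N) → ℕ)
    (hr : ∀ N, ∑ i, r N i = N) (hc : ∀ N, ∑ j, c N j = N)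
    (hr_anti : ∀ N, Antitone (r N)) (hc_anti : ∀ N, Antitone (c N))
    (hrc : ∀ N, firstEntry (c N) ≤ firstEntry (r N))
    (hsum : (fun N : ℕ => ∑ i, ∑ j,
        (r N i : ℝ) * ((r N i : ℝ) - 1) * (c N j : ℝ) * ((c N j : ℝ) - 1))
      =O[atTop] fun N : ℕ => (N : ℝ) ^ 2)
    (hr_small : (fun N : ℕ => (firstEntry (r N) : ℝ)) =o[atTop] fun N : ℕ => (N : ℝ)) :
    ∃ p : ℝ, 0 < p ∧ ∀ᶠ N : ℕ in atTop,
      p ≤ ((configurationModel (r N) (c N) ((hr N).trans (hc N).symm)).toOuterMeasure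
        (binaryTables (r N) (c N))).toReal := by
  obtain ⟨K, hK, hbound⟩ := hsum.exists_pos
  set L := max K 1
  have hL : 1 ≤ L := le_max_right _ _
  -- The local lemma gives `(1 - 2 / (N (N - 1))) ^ (A * B)`, where `2 / (N (N - 1)) ≤ 4 / N²`,
  -- `1 - x ≥ exp (-2 x)` for `x ≤ 1 / 2`, and `A * B ≤ L * N²`.
  refine ⟨Real.exp (-(8 * L)), Real.exp_pos _, ?_⟩
  have hε : (0 : ℝ) < 1 / (64 * (128 * L)) := by positivity
  filter_upwards [hbound.bound, hr_small.bound hε,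
    tendsto_natCast_atTop_atTop.eventually_ge_atTop (64 * (128 * L) ^ 2)] with N hAB ha hN
  rw [sum_sum_eq_card_mul_card, Real.norm_of_nonneg (by positivity),
    Real.norm_of_nonneg (by positivity)] at hAB
  rw [Real.norm_of_nonneg (by positivity), Real.norm_of_nonneg (by positivity),
    one_div_mul_eq_div] at ha
  have hN4 : (4 : ℝ) ≤ N := by nlinarith
  have hN2 : 2 ≤ N := by
    have : 4 ≤ N := by exact_mod_cast hN4
    omega
  have hABL : ((tokenPairs (r N)).card : ℝ) * (tokenPairs (c N)).card ≤ L * (N : ℝ) ^ 2 :=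
    hAB.trans (mul_le_mul_of_nonneg_right (le_max_left _ _) (by positivity))
  have hsmall := first_mul_pairs_add_le hL (Nat.cast_nonneg (firstEntry (c N)))
    (Nat.cast_le.2 (hrc N)) (Nat.cast_nonneg _) (Nat.cast_nonneg _)
    (by rw [← cast_mul_pred]; exact_mod_cast firstEntry_mul_pred_le (r N))
    (by rw [← cast_mul_pred]; exact_mod_cast firstEntry_mul_pred_le (c N))
    (by have h := card_tokenPairs_le (hr_anti N); rw [hr N] at h; exact_mod_cast h)
    (by have h := card_tokenPairs_le (hc_anti N); rw [hc N] at h; exact_mod_cast h)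
    hABL ha hN
  refine le_trans ?_ (one_sub_pow_le_configurationModel hN2 (hr N) (hc N) (hr_anti N) (hc_anti N)
    (by nlinarith))
  have hhalf : (N : ℝ) ^ 2 / 2 ≤ (N : ℝ) * (N - 1) := by nlinarith
  have hp : 2 * ((N : ℝ) * (N - 1))⁻¹ ≤ 4 / (N : ℝ) ^ 2 := by
    rw [← div_eq_mul_inv, div_le_div_iff₀ (by nlinarith) (by positivity)]
    linarith
  have hx : 4 / (N : ℝ) ^ 2 ≤ 1 / 2 := by
    rw [div_le_div_iff₀ (by positivity) (by norm_num)]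
    nlinarith
  calc Real.exp (-(8 * L))
      ≤ Real.exp (((tokenPairs (r N)).card * (tokenPairs (c N)).card : ℕ) *
          (-(2 * (4 / (N : ℝ) ^ 2)))) := by
        refine Real.exp_le_exp.2 ?_
        push_cast
        have h : ((tokenPairs (r N)).card : ℝ) * (tokenPairs (c N)).card * (8 / (N : ℝ) ^ 2) ≤
            8 * L := by
          rw [← mul_div_assoc, div_le_iff₀ (by positivity)]
          linarith
        have h' : 2 * (4 / (N : ℝ) ^ 2) = 8 / (N : ℝ) ^ 2 := by ring
        rw [h']
        linarith
    _ = Real.exp (-(2 * (4 / (N : ℝ) ^ 2))) ^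
          ((tokenPairs (r N)).card * (tokenPairs (c N)).card) := Real.exp_nat_mul _ _
    _ ≤ (1 - 2 * ((N : ℝ) * (N - 1))⁻¹) ^
          ((tokenPairs (r N)).card * (tokenPairs (c N)).card) := by
        refine pow_le_pow_left₀ (Real.exp_pos _).le ?_ _
        linarith [exp_neg_two_mul_le_one_sub (by positivity : 0 ≤ 4 / (N : ℝ) ^ 2) hx]
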